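/- Let $\Delta$ be a finite set. Rings are commutative with $1$; a differential ring is a ring $R$ together with pairwise commuting derivations of $R$ indexed by $\Delta$, and a differential ring is called a Ritt algebra if it contains $\mathbb{Q}$ (i.e. it is a $\mathbb{Q}$-algebra). The differential spectrum $\operatorname{Spec}^\Delta R$ is the set of prime ideals of $R$ that are stable under all the derivations. For $s \in R$, the localization $R_s = R[1/s]$ is a differential ring by the unique extension of the derivations (the quotient rule). Theorem. Let $A \subseteq B$ be Ritt algebras, the derivations of $B$ extending those of $A$. Suppose that $B$ is an integral domain and is differentially finitely generated over $A$, i.e. there is a finite set $S \subseteq B$ such that $B$ is the only $A$-subalgebra of $B$ that contains $S$ and is stable under all the derivations. Then there is a nonzero element $s \in A$ such that the map $\operatorname{Spec}^\Delta B_s \to \operatorname{Spec}^\Delta A_s$ that sends a prime differential ideal to its inverse image under the homomorphism $A_s \to B_s$ induced by the inclusion is surjective. -/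

import Mathlib

namespace DifferentialSpectrum

/-- A differential ring with derivations indexed by `Δ`: a commutative ring with pairwise commuting
derivations `d δ`, `δ ∈ Δ`. -/
class DiffRing (Δ : Type*) (A : Type*) [CommRing A] where
  d : Δ → Derivation ℤ A A
  d_comm : ∀ (i j : Δ) (a : A), d i (d j a) = d j (d i a)

/-- A differential homomorphism of differential rings. -/
structure DiffHom (Δ : Type*) (A B : Type*) [CommRing A] [CommRing B]
    [DiffRing Δ A] [DiffRing Δ B] extends A →+* B where
  map_d' : ∀ (i : Δ) (a : A),
    toRingHom (DiffRing.d i a) = DiffRing.d i (toRingHom a)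

/-- The structure map `A → B` of the algebra `B` over `A` is a differential homomorphism. -/
class DiffAlgebra (Δ : Type*) (A B : Type*) [CommRing A] [CommRing B] [Algebra A B]
    [DiffRing Δ A] [DiffRing Δ B] : Prop where
  algebraMap_d : ∀ (i : Δ) (a : A),
    algebraMap A B (DiffRing.d i a) = DiffRing.d i (algebraMap A B a)

/-- The smallest `A`-subalgebra of `B` that contains `S` and is stable under all derivations. -/
def diffAdjoin (Δ : Type*) (A : Type*) {B : Type*} [CommRing A] [CommRing B] [Algebra A B]
    [DiffRing Δ B] (S : Set B) : Subalgebra A B :=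
  sInf {C : Subalgebra A B | S ⊆ C ∧ ∀ (i : Δ), ∀ b ∈ C, DiffRing.d i b ∈ C}

/-- `B` is differentially finitely generated over `A`. -/
def DiffFinitelyGenerated (Δ : Type*) (A B : Type*) [CommRing A] [CommRing B] [Algebra A B]
    [DiffRing Δ B] : Prop :=
  ∃ S : Finset B, diffAdjoin Δ A (S : Set B) = ⊤

/-- An ideal is differential if it is stable under all derivations. -/
def IsDiffIdeal (Δ : Type*) {A : Type*} [CommRing A] [DiffRing Δ A] (I : Ideal A) : Prop :=
  ∀ (i : Δ), ∀ a ∈ I, DiffRing.d i a ∈ I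

/-- The differential spectrum: the set of prime differential ideals. -/
def DiffSpec (Δ : Type*) (A : Type*) [CommRing A] [DiffRing Δ A] : Type _ :=
  {p : PrimeSpectrum A // IsDiffIdeal Δ p.asIdeal}

/-- The map of differential spectra `q ↦ f⁻¹(q)` induced by a differential homomorphism `f`. -/
def DiffSpec.comap {Δ : Type*} {A B : Type*} [CommRing A] [CommRing B]
    [DiffRing Δ A] [DiffRing Δ B] (f : DiffHom Δ A B) (q : DiffSpec Δ B) : DiffSpec Δ A :=
  ⟨PrimeSpectrum.comap f.toRingHom q.1, fun i a ha => by
    have h : f.toRingHom a ∈ q.1.asIdeal := ha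
    have h2 := q.2 i _ h
    rw [← f.map_d'] at h2
    exact h2⟩

section Localization

/-- Maps on a localization that satisfy the Leibniz rule along a ring homomorphism and agree on
`A` are equal. -/
theorem eq_of_leibniz {A : Type*} [CommRing A] (M : Submonoid A) (L : Type*) [CommRing L]
    [Algebra A L] [IsLocalization M L] {R : Type*} [CommRing R] (f : L →+* R) (D E : L → R)
    (hD : ∀ x y, D (x * y) = f x * D y + f y * D x)
    (hE : ∀ x y, E (x * y) = f x * E y + f y * E x)
    (h : ∀ a : A, D (algebraMap A _ a) = E (algebraMap A _ a)) (x : L) : D x = E x := by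
  obtain ⟨a, m, rfl⟩ := IsLocalization.exists_mk'_eq M x
  have hm : IsLocalization.mk' L a m * algebraMap A _ (m : A) = algebraMap A _ a :=
    IsLocalization.mk'_spec _ a m
  have hu : IsUnit (f (algebraMap A L (m : A))) := (IsLocalization.map_units L m).map f
  have h1 := h a
  rw [← hm, hD, hE, h, add_right_inj] at h1
  exact hu.mul_left_cancel h1

variable {A : Type*} [CommRing A] (M : Submonoid A) (L : Type*) [CommRing L] [Algebra A L]

/-- The ring homomorphism `a ↦ a + ε D(a)` from `A` to the dual numbers over an `A`-algebra. -/
def dualHom (D : Derivation ℤ A A) : A →+* TrivSqZeroExt L L where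
  toFun a := TrivSqZeroExt.inl (algebraMap A L a) + TrivSqZeroExt.inr (algebraMap A L (D a))
  map_one' := by ext <;> simp
  map_zero' := by ext <;> simp
  map_add' a b := by
    ext
    · simp
    · simp only [map_add, TrivSqZeroExt.snd_add, TrivSqZeroExt.snd_inl, TrivSqZeroExt.snd_inr]
      ring
  map_mul' a b := by
    ext
    · simp
    · simp only [map_add, map_mul, Derivation.leibniz, TrivSqZeroExt.snd_add,
        TrivSqZeroExt.snd_inl, TrivSqZeroExt.snd_inr, TrivSqZeroExt.snd_mul,
        TrivSqZeroExt.fst_add, TrivSqZeroExt.fst_inl, TrivSqZeroExt.fst_inr,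
        op_smul_eq_smul, smul_eq_mul]
      ring

variable [IsLocalization M L]

theorem dualHom_isUnit (D : Derivation ℤ A A) (y : M) : IsUnit (dualHom L D y) := by
  rw [TrivSqZeroExt.isUnit_iff_isUnit_fst]
  simpa [dualHom] using IsLocalization.map_units L y

/-- The extension `x ↦ x + ε D(x)` of `dualHom` to the localization `L = M⁻¹A`. -/
noncomputable def dualLift (D : Derivation ℤ A A) : L →+* TrivSqZeroExt L L :=
  IsLocalization.lift (M := M) (g := dualHom L D) (dualHom_isUnit M L D)

theorem fst_dualLift (D : Derivation ℤ A A) (x : L) : (dualLift M L D x).fst = x := by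
  have h : ((TrivSqZeroExt.fstHom L L L).toRingHom.comp (dualLift M L D)) = RingHom.id _ := by
    apply IsLocalization.ringHom_ext M
    ext a
    change (dualLift M L D (algebraMap A L a)).fst = _
    rw [dualLift, IsLocalization.lift_eq]
    simp [dualHom]
  exact congrArg (fun g => g x) h

/-- The derivation of the localization `L = M⁻¹A` that extends the derivation `D` of `A`
(the unique one, given by the quotient rule). -/
noncomputable def locDerivation (D : Derivation ℤ A A) : Derivation ℤ L L :=
  Derivation.mk'
    ({ toFun := fun x => (dualLift M L D x).snd
       map_zero' := by simp
       map_add' := fun x y => by simp } : L →+ L).toIntLinearMap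
    (fun x y => by
      change (dualLift M L D (x * y)).snd =
        x • (dualLift M L D y).snd + y • (dualLift M L D x).snd
      simp [fst_dualLift, mul_comm])

theorem locDerivation_algebraMap (D : Derivation ℤ A A) (a : A) :
    locDerivation M L D (algebraMap A L a) = algebraMap A L (D a) := by
  change (dualLift M L D (algebraMap A _ a)).snd = _
  rw [dualLift, IsLocalization.lift_eq]
  change (TrivSqZeroExt.inl (algebraMap A L a) + TrivSqZeroExt.inr (algebraMap A L (D a))).snd = _
  simp only [TrivSqZeroExt.snd_add, TrivSqZeroExt.snd_inl, TrivSqZeroExt.snd_inr, zero_add]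

/-- The differential ring structure on the localization `L = M⁻¹A` of a differential ring `A`. -/
@[reducible]
noncomputable def diffRingOfIsLocalization (Δ : Type*) [DiffRing Δ A] : DiffRing Δ L where
  d i := locDerivation M L (DiffRing.d i)
  d_comm i j x := by
    have key : ⁅locDerivation M L (DiffRing.d i), locDerivation M L (DiffRing.d j)⁆ x = 0 := by
      refine eq_of_leibniz M L (RingHom.id L)
        (fun x => ⁅locDerivation M L (DiffRing.d i), locDerivation M L (DiffRing.d j)⁆ x)
        (fun _ => 0) ?_ ?_ ?_ x
      · intro x y
        simp only [Derivation.leibniz, smul_eq_mul, RingHom.id_apply]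
      · intro x y
        simp
      · intro a
        simp [Derivation.commutator_apply, locDerivation_algebraMap, DiffRing.d_comm i j a]
    rw [Derivation.commutator_apply] at key
    exact sub_eq_zero.mp key

end Localization

noncomputable instance instDiffRingAway {Δ A : Type*} [CommRing A] [DiffRing Δ A] (s : A) :
    DiffRing Δ (Localization.Away s) :=
  diffRingOfIsLocalization (Submonoid.powers s) (Localization.Away s) Δ

theorem d_algebraMap_away {Δ A : Type*} [CommRing A] [DiffRing Δ A] (s : A) (i : Δ) (a : A) :
    DiffRing.d i (algebraMap A (Localization.Away s) a) =
      algebraMap A (Localization.Away s) (DiffRing.d i a) :=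
  locDerivation_algebraMap (Submonoid.powers s) (Localization.Away s) (DiffRing.d i) a

/-- The differential homomorphism `A_s → B_s` induced by the structure map `A → B`. -/
noncomputable def awayDiffHom (Δ : Type*) (A B : Type*) [CommRing A] [CommRing B] [Algebra A B]
    [DiffRing Δ A] [DiffRing Δ B] [DiffAlgebra Δ A B] (s : A) :
    DiffHom Δ (Localization.Away s) (Localization.Away (algebraMap A B s)) where
  toRingHom := Localization.awayMap (algebraMap A B) s
  map_d' i x := by
    refine eq_of_leibniz (Submonoid.powers s) (Localization.Away s) (Localization.awayMap (algebraMap A B) s)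
      (fun x => Localization.awayMap (algebraMap A B) s (DiffRing.d i x))
      (fun x => DiffRing.d i (Localization.awayMap (algebraMap A B) s x)) ?_ ?_ ?_ x
    · intro x y
      simp
    · intro x y
      simp
    · intro a
      have e : ∀ a : A, Localization.awayMap (algebraMap A B) s
          (algebraMap A (Localization.Away s) a) =
          algebraMap B (Localization.Away (algebraMap A B s)) (algebraMap A B a) :=
        fun a => by simp [Localization.awayMap, IsLocalization.Away.map]
      simp only [d_algebraMap_away, e, DiffAlgebra.algebraMap_d]

end DifferentialSpectrum

namespace DifferentialSpectrum

/-! It suffices to treat plain primes: for some nonzero s in A, every prime p of A avoiding s is the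
contraction of a prime q of B (`exists_prime_over`). If p is differential, so is pB ⊆ q. The largest
differential ideal inside q is prime, because binomial coefficients are units in a Ritt algebra;
lying between pB and q, it contracts to p (`exists_isPrime_isDiffIdeal_le`).

To find s, well-order the derivatives of the generators compatibly with the derivations, and call
one a leader if it is algebraic over the lower ones. Differentiating its equation shows that the
separant times any derivative of a leader is a polynomial in lower elements. So leaders are stable
under differentiation, and by Dickson's lemma they all come from a finite set T of them. Inside Frac
B, the ring B then lies in the A-algebra generated by the non-leaders x, which are algebraically
independent, and finitely many elements algebraic over A[x]: those of T and the inverses of their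
separants. These become integral over A[x] after inverting some g ≠ 0. Take for s a nonzero
coefficient of g: if s ∉ p, then g ∉ pA[x], and lying over applies. -/

/-! ### Prime differential ideals inside a prime -/

/-- In the Leibniz expansion of D^N(xy), every term but the (m, n) one has a factor D^i x with i < m
or D^j y with j < n. The induction on N uses Pascal's rule. -/
theorem iterate_derivation_mul_sub_mem {B : Type*} [CommRing B] (D : Derivation ℤ B B)
    (q : Ideal B) (N : ℕ) : ∀ (m n : ℕ), m + n = N → ∀ x y : B,
      (∀ i < m, D^[i] x ∈ q) → (∀ j < n, D^[j] y ∈ q) →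
      D^[N] (x * y) - (N.choose m : B) * (D^[m] x * D^[n] y) ∈ q := by
  induction N with
  | zero =>
    intro m n h x y _ _
    obtain ⟨rfl, rfl⟩ : m = 0 ∧ n = 0 := by omega
    simp
  | succ N ih =>
    intro m n h x y hx hy
    have hD : D^[N + 1] (x * y) = D^[N] (x * D y) + D^[N] (D x * y) := by
      rw [Function.iterate_succ_apply, Derivation.leibniz, smul_eq_mul, smul_eq_mul,
        mul_comm y, iterate_map_add]
    rw [hD]
    rcases m with _ | m
    · obtain rfl : n = N + 1 := by omega
      have h1 := ih 0 N (by omega) x (D y) (by simp)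
        (fun j hj => hy (j + 1) (by omega))
      have h2 := ih 0 N (by omega) (D x) y (by simp) (fun j hj => hy j (by omega))
      have h3 := q.mul_mem_left (((N.choose 0 : ℕ) : B) * D^[0] (D x)) (hy N (by omega))
      convert q.add_mem h1 (q.add_mem h2 h3) using 1
      simp only [Nat.choose_zero_right, Function.iterate_succ_apply]
      ring
    · rcases n with _ | n
      · obtain rfl : m = N := by omega
        have h1 := ih m 0 (by omega) (D x) y
          (fun j hj => hx (j + 1) (by omega))
          (by simp)
        have h2 := ih m 0 (by omega) x (D y) (fun j hj => hx j (by omega)) (by simp)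
        have h3 := q.mul_mem_left (((m.choose m : ℕ) : B) * D^[0] (D y)) (hx m (by omega))
        convert q.add_mem h1 (q.add_mem h2 h3) using 1
        simp only [Nat.choose_self, Function.iterate_succ_apply]
        ring
      · have h1 := ih (m + 1) n (by omega) x (D y) hx
          (fun j hj => hy (j + 1) (by omega))
        have h2 := ih m (n + 1) (by omega) (D x) y
          (fun j hj => hx (j + 1) (by omega)) hy
        convert q.add_mem h1 h2 using 1
        rw [Nat.choose_succ_succ]
        simp only [Function.iterate_succ_apply]
        push_cast
        ring

/-- The largest ideal contained in `q` that is stable under the derivation `D`. -/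
def derivationCore {B : Type*} [CommRing B] (D : Derivation ℤ B B) (q : Ideal B) : Ideal B where
  carrier := {b | ∀ n, D^[n] b ∈ q}
  zero_mem' n := by simp
  add_mem' {a b} ha hb n := by
    rw [iterate_map_add]
    exact q.add_mem (ha n) (hb n)
  smul_mem' c x hx n := by
    have key : ∀ n, ∀ c x : B, (∀ k, D^[k] x ∈ q) → D^[n] (c * x) ∈ q := by
      intro n
      induction n with
      | zero => exact fun c x hx => q.mul_mem_left c (hx 0)
      | succ n ih =>
        intro c x hx
        rw [Function.iterate_succ_apply, Derivation.leibniz, smul_eq_mul, smul_eq_mul,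
          mul_comm x, iterate_map_add]
        exact q.add_mem (ih _ _ fun k => hx (k + 1)) (ih _ _ hx)
    exact key n c x hx

theorem mem_derivationCore {B : Type*} [CommRing B] {D : Derivation ℤ B B} {q : Ideal B} {b : B} :
    b ∈ derivationCore D q ↔ ∀ n, D^[n] b ∈ q := Iff.rfl

/-- In a Ritt algebra the largest `D`-stable ideal contained in a prime ideal is prime. -/
theorem derivationCore_isPrime {B : Type*} [CommRing B] [Algebra ℚ B] (D : Derivation ℤ B B)
    (q : Ideal B) [hq : q.IsPrime] : (derivationCore D q).IsPrime where
  ne_top' h := hq.ne_top ((Ideal.eq_top_iff_one q).mpr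
    (mem_derivationCore.mp (h ▸ Submodule.mem_top : (1 : B) ∈ derivationCore D q) 0))
  mem_or_mem' {x y} hxy := by
    classical
    by_contra! hcon
    obtain ⟨hx, hy⟩ := hcon
    rw [mem_derivationCore, not_forall] at hx hy
    -- With the least orders at which x and y leave q, a single Leibniz term is not visibly in q.
    have h := iterate_derivation_mul_sub_mem D q _ (Nat.find hx) (Nat.find hy) rfl x y
      (fun i hi => not_not.mp (Nat.find_min hx hi)) (fun i hi => not_not.mp (Nat.find_min hy hi))
    replace h := q.sub_mem (hxy (Nat.find hx + Nat.find hy)) h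
    rw [sub_sub_cancel] at h
    have hc : IsUnit (((Nat.find hx + Nat.find hy).choose (Nat.find hx) : ℕ) : B) := by
      have : IsUnit (((Nat.find hx + Nat.find hy).choose (Nat.find hx) : ℕ) : ℚ) :=
        IsUnit.mk0 _ (Nat.cast_ne_zero.mpr (Nat.choose_pos (Nat.le_add_right _ _)).ne')
      simpa using this.map (algebraMap ℚ B)
    rw [Ideal.unit_mul_mem_iff_mem _ hc] at h
    exact (hq.mem_or_mem h).elim (Nat.find_spec hx) (Nat.find_spec hy)

/-- In a Ritt algebra a prime ideal contains a prime differential ideal that contains all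
differential ideals contained in the given prime. -/
theorem exists_isPrime_isDiffIdeal_le {Δ : Type*} [Finite Δ] {B : Type*} [CommRing B] [Algebra ℚ B]
    [DiffRing Δ B] (q : Ideal B) [q.IsPrime] :
    ∃ q' : Ideal B, q'.IsPrime ∧ IsDiffIdeal Δ q' ∧ q' ≤ q ∧
      ∀ I : Ideal B, IsDiffIdeal Δ I → I ≤ q → I ≤ q' := by
  classical
  have := Fintype.ofFinite Δ
  have key : ∀ s : Finset Δ, ∃ q' : Ideal B, q'.IsPrime ∧
      (∀ i ∈ s, ∀ a ∈ q', DiffRing.d i a ∈ q') ∧ q' ≤ q ∧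
      ∀ I : Ideal B, IsDiffIdeal Δ I → I ≤ q → I ≤ q' := by
    intro s
    induction s using Finset.induction_on with
    | empty => exact ⟨q, inferInstance, by simp, le_rfl, fun I _ h => h⟩
    | insert i s _ ih =>
      obtain ⟨q', hq', hs, hle, hI⟩ := ih
      refine ⟨derivationCore (DiffRing.d i) q', derivationCore_isPrime _ _, ?_,
        fun a ha => hle (ha 0), fun I hID hIq a ha n => hI I hID hIq ?_⟩
      · intro j hj a ha n
        rcases Finset.mem_insert.mp hj with rfl | hj
        · exact ha (n + 1)
        -- Stability under the earlier derivations survives because they commute with the new one.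
        · have hc : Function.Commute (DiffRing.d (A := B) i) (DiffRing.d (A := B) j) :=
            fun b => DiffRing.d_comm i j b
          rw [(hc.iterate_left n).eq]
          exact hs j hj _ (ha n)
      · induction n generalizing a with
        | zero => exact ha
        | succ n ih => exact ih _ (hID i a ha)
  obtain ⟨q', h1, h2, h3, h4⟩ := key Finset.univ
  exact ⟨q', h1, fun i => h2 i (Finset.mem_univ i), h3, h4⟩

theorem isDiffIdeal_map {Δ A B : Type*} [CommRing A] [CommRing B] [Algebra A B]
    [DiffRing Δ A] [DiffRing Δ B] [DiffAlgebra Δ A B] {p : Ideal A} (hp : IsDiffIdeal Δ p) :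
    IsDiffIdeal Δ (p.map (algebraMap A B)) := by
  intro i a ha
  refine Submodule.span_induction ?_ (by simp) ?_ ?_ ha
  · rintro _ ⟨x, hx, rfl⟩
    rw [← DiffAlgebra.algebraMap_d]
    exact Ideal.mem_map_of_mem _ (hp i x hx)
  · intro x y _ _ hx hy
    rw [map_add]
    exact Ideal.add_mem _ hx hy
  · intro c x hx' hx
    rw [smul_eq_mul, Derivation.leibniz, smul_eq_mul, smul_eq_mul]
    exact Ideal.add_mem _ (Ideal.mul_mem_left _ _ hx) (Ideal.mul_mem_right _ _ hx')

/-! ### Lying over up to a denominator -/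

/-- The elements of an `R`-algebra that become integral after multiplication by a power of `g`. -/
def awayIntegralClosure {R : Type*} (L : Type*) [CommRing R] [CommRing L] [Algebra R L] (g : R) :
    Subalgebra R L where
  carrier := {z | ∃ n : ℕ, IsIntegral R (g ^ n • z)}
  mul_mem' := by
    rintro a b ⟨m, hm⟩ ⟨n, hn⟩
    refine ⟨m + n, ?_⟩
    rw [pow_add, mul_smul_mul_comm]
    exact hm.mul hn
  add_mem' := by
    rintro a b ⟨m, hm⟩ ⟨n, hn⟩
    refine ⟨m + n, ?_⟩
    rw [smul_add]
    nth_rewrite 1 [add_comm m n]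
    rw [pow_add, pow_add, mul_smul, mul_smul]
    exact (hm.smul _).add (hn.smul _)
  algebraMap_mem' r := ⟨0, by simpa using isIntegral_algebraMap⟩

theorem mem_awayIntegralClosure {R L : Type*} [CommRing R] [CommRing L] [Algebra R L] {g : R}
    {z : L} : z ∈ awayIntegralClosure L g ↔ ∃ n : ℕ, IsIntegral R (g ^ n • z) := Iff.rfl

/-- Lying over for algebras that are integral up to powers of `g`. -/
theorem exists_isPrime_of_awayIntegralClosure {R B L : Type*} [CommRing R] [CommRing B]
    [CommRing L] [IsDomain L] [Algebra R L] (hinj : Function.Injective (algebraMap R L))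
    (f : B →+* L) (g : R) (hf : ∀ b, f b ∈ awayIntegralClosure L g) (P : Ideal R) [hP : P.IsPrime]
    (hg : g ∉ P) :
    ∃ Q : Ideal B, Q.IsPrime ∧ ∀ (r : R) (b : B), f b = algebraMap R L r → (b ∈ Q ↔ r ∈ P) := by
  have hinj' : Function.Injective (algebraMap R (integralClosure R L)) := by
    intro a b h
    exact hinj (congrArg (fun t : integralClosure R L => (t : L)) h)
  obtain ⟨Q', hQ', hQP⟩ := Ideal.exists_ideal_over_prime_of_isIntegral_of_isDomain
    (S := integralClosure R L) P (by
      rw [(RingHom.injective_iff_ker_eq_bot _).mp hinj']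
      exact bot_le)
  have hmem : ∀ r : R, algebraMap R (integralClosure R L) r ∈ Q' ↔ r ∈ P := by
    intro r
    rw [← hQP, Ideal.mem_comap]
  have hgn : ∀ n : ℕ, g ^ n ∉ P := fun n h => hg (hP.mem_of_pow_mem n h)
  have hsmul : ∀ (r : R) (t : integralClosure R L), r • t ∈ Q' → r ∉ P → t ∈ Q' := by
    intro r t h hr
    rw [Algebra.smul_def] at h
    exact (hQ'.mem_or_mem h).resolve_left (fun h => hr ((hmem r).mp h))
  -- The pullback to B of the extension of Q' to the integral closure localized at g, written
  -- without localizing.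
  let Q : Ideal B :=
    { carrier := {b | ∃ n : ℕ, ∃ t ∈ Q', (t : L) = g ^ n • f b}
      zero_mem' := ⟨0, 0, Q'.zero_mem, by simp⟩
      add_mem' := by
        rintro a b ⟨m, t, ht, h⟩ ⟨n, u, hu, h'⟩
        refine ⟨m + n, g ^ n • t + g ^ m • u, Q'.add_mem (Submodule.smul_of_tower_mem _ _ ht)
          (Submodule.smul_of_tower_mem _ _ hu), ?_⟩
        push_cast
        rw [h, h', smul_smul, smul_smul, map_add, smul_add, ← pow_add, ← pow_add, add_comm n m]
      smul_mem' := by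
        rintro c b ⟨n, t, ht, h⟩
        obtain ⟨m, hm⟩ := hf c
        refine ⟨m + n, ⟨_, hm⟩ * t, Q'.mul_mem_left _ ht, ?_⟩
        push_cast
        rw [h, smul_eq_mul, map_mul, pow_add, mul_smul_mul_comm] }
  have hQ : ∀ b, b ∈ Q ↔ ∃ n : ℕ, ∃ t ∈ Q', (t : L) = g ^ n • f b := fun b => Iff.rfl
  have hover : ∀ (r : R) (b : B), f b = algebraMap R L r → (b ∈ Q ↔ r ∈ P) := by
    intro r b hb
    rw [hQ]
    constructor
    · rintro ⟨n, t, ht, h⟩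
      have : t = g ^ n • algebraMap R (integralClosure R L) r := by
        apply Subtype.ext
        rw [h, hb]
        rfl
      exact (hmem r).mp (hsmul _ _ (this ▸ ht) (hgn n))
    · intro hr
      exact ⟨0, _, (hmem r).mpr hr, by rw [hb, pow_zero, one_smul]; rfl⟩
  refine ⟨Q, ⟨?_, ?_⟩, hover⟩
  · rw [Ideal.ne_top_iff_one, hover 1 1 (by simp)]
    exact fun h => hP.ne_top ((Ideal.eq_top_iff_one P).mpr h)
  · intro a b hab
    obtain ⟨n, t, ht, h⟩ := (hQ _).mp hab
    obtain ⟨k, hk⟩ := hf a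
    obtain ⟨l, hl⟩ := hf b
    have key : g ^ n • ((⟨_, hk⟩ : integralClosure R L) * ⟨_, hl⟩) = g ^ (k + l) • t := by
      apply Subtype.ext
      push_cast
      rw [h, map_mul, pow_add, smul_mul_smul_comm, smul_comm]
    have := hsmul _ _ (key ▸ Submodule.smul_of_tower_mem _ _ ht) (hgn n)
    exact (hQ'.mem_or_mem this).imp (fun h => ⟨k, _, h, rfl⟩) (fun h => ⟨l, _, h, rfl⟩)

/-- Finitely many algebraic elements become integral after inverting one nonzero element. -/
theorem exists_ne_zero_adjoin_le_awayIntegralClosure {R L : Type*} [CommRing R] [IsDomain R]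
    [CommRing L] [Algebra R L] (E : Finset L) (hE : ∀ e ∈ E, IsAlgebraic R e) :
    ∃ g : R, g ≠ 0 ∧ Algebra.adjoin R (E : Set L) ≤ awayIntegralClosure L g := by
  classical
  choose! c hc hint using fun e he => (hE e he).exists_integral_multiple
  refine ⟨∏ e ∈ E, c e, Finset.prod_ne_zero_iff.mpr hc, Algebra.adjoin_le fun e he => ⟨1, ?_⟩⟩
  rw [pow_one, ← Finset.prod_erase_mul E c he, mul_smul]
  exact (hint e he).smul _

/-- Generic lying over for domains generated by algebraically independent elements and finitely
many elements that are algebraic over those. -/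
theorem exists_forall_isPrime_comap_eq {A B L σ : Type*} [CommRing A] [IsDomain A] [CommRing B]
    [Algebra A B] [CommRing L] [IsDomain L] [Algebra A L] (f : B →ₐ[A] L) {x : σ → L}
    (hx : AlgebraicIndependent A x) (E : Finset L)
    (hE : ∀ e ∈ E, IsAlgebraic (Algebra.adjoin A (Set.range x)) e)
    (hf : f.range ≤ Algebra.adjoin A (Set.range x ∪ E)) :
    ∃ s : A, s ≠ 0 ∧ ∀ p : Ideal A, p.IsPrime → s ∉ p →
      ∃ q : Ideal B, q.IsPrime ∧ q.comap (algebraMap A B) = p := by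
  let : Algebra (MvPolynomial σ A) L := (MvPolynomial.aeval (R := A) x).toAlgebra
  have halg : ∀ r : MvPolynomial σ A, algebraMap (MvPolynomial σ A) L r = MvPolynomial.aeval x r :=
    fun r => rfl
  have : IsScalarTower A (MvPolynomial σ A) L := IsScalarTower.of_algebraMap_eq fun a => by
    rw [halg, MvPolynomial.algebraMap_eq, MvPolynomial.aeval_C]
  have hinj : Function.Injective (algebraMap (MvPolynomial σ A) L) := hx
  have hE' : ∀ e ∈ E, IsAlgebraic (MvPolynomial σ A) e := by
    intro e he
    refine (isAlgebraic_ringHom_iff_of_comp_eq hx.aevalEquiv.toRingEquiv (RingHom.id L)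
      Function.injective_id (RingHom.ext fun r => rfl)).mp (hE e he)
  obtain ⟨g, hg, hle⟩ := exists_ne_zero_adjoin_le_awayIntegralClosure E hE'
  obtain ⟨m, hm⟩ := MvPolynomial.ne_zero_iff.mp hg
  -- A polynomial lies in the extension of p exactly when all its coefficients lie in p, so one
  -- coefficient outside p keeps g out.
  refine ⟨g.coeff m, hm, fun p hp hmp => ?_⟩
  have hP : (p.map (MvPolynomial.C (σ := σ))).IsPrime := by
    have := RingHom.ker_isPrime (MvPolynomial.map (σ := σ) (Ideal.Quotient.mk p))
    rwa [MvPolynomial.ker_map, Ideal.mk_ker] at this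
  have hgP : g ∉ p.map (MvPolynomial.C (σ := σ)) := fun h =>
    hmp (MvPolynomial.mem_map_C_iff.mp h m)
  obtain ⟨Q, hQ, hover⟩ := exists_isPrime_of_awayIntegralClosure hinj f.toRingHom g (fun b => by
    have h1 : f b ∈ Algebra.adjoin A (Set.range x ∪ E) := hf ⟨b, rfl⟩
    have h2 : Algebra.adjoin A (Set.range x ∪ E) ≤
        (awayIntegralClosure L g).restrictScalars A := by
      refine Algebra.adjoin_le (Set.union_subset ?_ fun e he => hle (Algebra.subset_adjoin he))
      rintro _ ⟨i, rfl⟩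
      have := (awayIntegralClosure L g).algebraMap_mem (MvPolynomial.X i)
      rwa [halg, MvPolynomial.aeval_X] at this
    exact h2 h1) _ hgP
  refine ⟨Q, hQ, ?_⟩
  ext a
  rw [Ideal.mem_comap, hover (MvPolynomial.C a) _ (by simp [halg])]
  rw [MvPolynomial.mem_map_C_iff]
  classical
  refine ⟨fun h => by simpa using h 0, fun h n => ?_⟩
  rw [MvPolynomial.coeff_C]
  split_ifs
  exacts [h, p.zero_mem]

/-! ### Algebraic independence and separants -/

-- Independence is tested on finite subsets, which can be built up by adjoining a new maximum each
-- time.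
open Algebra Set in
theorem algebraicIndependent_of_linearOrder {ι A L : Type*} [LinearOrder ι] [CommRing A]
    [CommRing L] [Algebra A L] (hinj : Function.Injective (algebraMap A L)) (x : ι → L)
    (h : ∀ i, Transcendental (adjoin A (x '' Iio i)) (x i)) : AlgebraicIndependent A x := by
  classical
  refine algebraicIndependent_of_finite_type fun t ht => ?_
  obtain ⟨s, rfl⟩ := ht.exists_finset_coe
  change AlgebraicIndepOn A x (s : Set ι)
  induction s using Finset.induction_on_max with
  | empty => simpa [AlgebraicIndepOn, algebraicIndependent_empty_type_iff] using hinj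
  | insert a s hs ih =>
    rw [Finset.coe_insert]
    refine (ih s.finite_toSet).insert fun halg => h a ?_
    have hle : adjoin A (x '' s) ≤ adjoin A (x '' Iio a) :=
      adjoin_mono (image_mono fun b hb => hs b hb)
    exact halg.ringHom_of_comp_eq (Subalgebra.inclusion hle).toRingHom (RingHom.id L)
      (Subalgebra.inclusion_injective hle) rfl

theorem isAlgebraic_of_mul_mem {A B : Type*} [CommRing A] [CommRing B] [Algebra A B]
    (C : Subalgebra A B) {c z : B} (hc : c ∈ C) (h0 : c ≠ 0) (h : c * z ∈ C) :
    IsAlgebraic C z := by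
  refine ⟨Polynomial.C ⟨c, hc⟩ * Polynomial.X - Polynomial.C ⟨c * z, h⟩, fun h1 => h0 ?_, ?_⟩
  · have := congrArg (fun f => f.coeff 1) h1
    simpa [Polynomial.coeff_C] using congrArg Subtype.val this
  · simp

/-- If the derivative also kills y, it is a nonzero annihilator of smaller degree, by characteristic
zero; descend. -/
theorem exists_aeval_derivative_ne_zero {C B : Type*} [CommRing C] [IsDomain C] [CharZero C]
    [CommRing B] [Algebra C B] (hinj : Function.Injective (algebraMap C B)) {y : B}
    (hy : IsAlgebraic C y) :
    ∃ f : Polynomial C, Polynomial.aeval y f = 0 ∧ Polynomial.aeval y f.derivative ≠ 0 := by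
  obtain ⟨f, hf0, hf⟩ := hy
  induction hn : f.natDegree using Nat.strong_induction_on generalizing f with
  | _ n ih =>
    by_cases h : Polynomial.aeval y f.derivative = 0
    · have hdeg : f.natDegree ≠ 0 := by
        intro hd
        rw [Polynomial.natDegree_eq_zero] at hd
        obtain ⟨c, rfl⟩ := hd
        rw [Polynomial.aeval_C, map_eq_zero_iff _ hinj] at hf
        exact hf0 (by rw [hf, map_zero])
      exact ih _ (hn ▸ Polynomial.natDegree_derivative_lt hdeg) _
        (fun h' => hdeg (Polynomial.derivative_eq_zero.mp h')) h rfl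
    · exact ⟨f, hf, h⟩

/-- The difference is the value at y of f with D applied to its coefficients. -/
theorem derivation_aeval_sub_mem {A B : Type*} [CommRing A] [CommRing B] [Algebra A B]
    (D : Derivation ℤ B B) {C C' : Subalgebra A B} (hD : ∀ c ∈ C, D c ∈ C') {y : B} (hy : y ∈ C')
    (f : Polynomial C) :
    D (Polynomial.aeval y f) - Polynomial.aeval y f.derivative * D y ∈ C' := by
  induction f using Polynomial.induction_on' with
  | add f g hf hg =>
    convert C'.add_mem hf hg using 1
    simp only [map_add]
    ring
  | monomial n c =>
    convert C'.mul_mem (C'.pow_mem hy n) (hD c c.2) using 1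
    rw [Polynomial.derivative_monomial, Polynomial.aeval_monomial, Polynomial.aeval_monomial,
      Derivation.leibniz, Derivation.leibniz_pow, map_mul, map_natCast]
    simp only [smul_eq_mul, nsmul_eq_mul, Subalgebra.algebraMap_def, Algebra.algebraMap_self_apply]
    ring

/-! ### Generators indexed by a ranking -/

section

variable {Δ A B : Type*} [CommRing A] [CommRing B] [Algebra A B] [DiffRing Δ A] [DiffRing Δ B]
  [DiffAlgebra Δ A B]

theorem d_mem_adjoin (i : Δ) {U V : Set B} (hUV : U ⊆ V)
    (hd : ∀ u ∈ U, DiffRing.d i u ∈ Algebra.adjoin A V) {b : B} (hb : b ∈ Algebra.adjoin A U) :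
    DiffRing.d i b ∈ Algebra.adjoin A V := by
  have hle := Algebra.adjoin_mono (R := A) hUV
  induction hb using Algebra.adjoin_induction with
  | mem x hx => exact hd x hx
  | algebraMap a =>
    rw [← DiffAlgebra.algebraMap_d]
    exact Subalgebra.algebraMap_mem _ _
  | add x y _ _ hx hy =>
    rw [map_add]
    exact add_mem hx hy
  | mul x y hx' hy' hx hy =>
    rw [Derivation.leibniz, smul_eq_mul, smul_eq_mul]
    exact add_mem (mul_mem (hle hx') hy) (mul_mem (hle hy') hx)

variable [IsDomain B] [CharZero B] {W : Type*} [LinearOrder W] {shift : Δ → W → W} {y : W → B}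

open Algebra Set

/-- The derivatives of an algebraic element are, up to the separant, polynomials in lower
elements. -/
theorem exists_separant (hs : ∀ i, StrictMono (shift i)) (hlt : ∀ i w, w < shift i w)
    (hy : ∀ i w, DiffRing.d i (y w) = y (shift i w)) {w : W}
    (hw : IsAlgebraic (adjoin A (y '' Iio w)) (y w)) :
    ∃ S ∈ adjoin A (y '' Iic w), S ≠ 0 ∧
      ∀ i, S * y (shift i w) ∈ adjoin A (y '' Iio (shift i w)) := by
  have : CharZero (adjoin A (y '' Iio w)) :=
    (algebraMap (adjoin A (y '' Iio w)) B).charZero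
  obtain ⟨f, hf, hf'⟩ := exists_aeval_derivative_ne_zero Subtype.val_injective hw
  have hle : adjoin A (y '' Iio w) ≤ adjoin A (y '' Iic w) :=
    adjoin_mono (image_mono Iio_subset_Iic_self)
  refine ⟨_, ?_, hf', fun i => ?_⟩
  · rw [Polynomial.aeval_eq_sum_range]
    exact sum_mem fun k _ => by
      rw [Algebra.smul_def]
      exact mul_mem (hle (SetLike.coe_mem _)) (pow_mem (subset_adjoin (mem_image_of_mem y self_mem_Iic)) _)
  · have h := derivation_aeval_sub_mem (A := A) (DiffRing.d i)
      (C := adjoin A (y '' Iio w)) (C' := adjoin A (y '' Iio (shift i w))) (fun c hc => d_mem_adjoin i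
        (image_mono (Iio_subset_Iio (hlt i w).le)) ?_ hc) (subset_adjoin (mem_image_of_mem y (hlt i w))) f
    · rw [hf, map_zero, zero_sub, neg_mem_iff, hy] at h
      exact h
    · rintro _ ⟨j, hj, rfl⟩
      rw [hy]
      exact subset_adjoin ⟨_, hs i hj, rfl⟩

/-- The hypothesis `hfin` is Dickson's lemma for the ranking; the set `U` below consists of the
leaders. -/
theorem exists_prime_over_of_ranking [WellFoundedLT W]
    (hinj : Function.Injective (algebraMap A B))
    (hs : ∀ i, StrictMono (shift i)) (hlt : ∀ i w, w < shift i w)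
    (hy : ∀ i w, DiffRing.d i (y w) = y (shift i w)) (hgen : adjoin A (range y) = ⊤)
    (hfin : ∀ U : Set W, (∀ i, ∀ w ∈ U, shift i w ∈ U) → ∃ T : Finset W, ↑T ⊆ U ∧
      ∀ V : Set W, ↑T ⊆ V → (∀ i, ∀ w ∈ V, shift i w ∈ V) → U ⊆ V) :
    ∃ s : A, s ≠ 0 ∧ ∀ p : Ideal A, p.IsPrime → s ∉ p →
      ∃ q : Ideal B, q.IsPrime ∧ q.comap (algebraMap A B) = p := by
  classical
  have : IsDomain A := hinj.isDomain (algebraMap A B)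
  set U : Set W := {w | IsAlgebraic (adjoin A (y '' Iio w)) (y w)}
  have hsep : ∀ w ∈ U, _ := fun w hw => exists_separant hs hlt hy hw
  choose! S hSmem hS0 hSshift using hsep
  have hIic : ∀ {v w : W}, v < w → adjoin A (y '' Iic v) ≤ adjoin A (y '' Iio w) := fun h =>
    adjoin_mono (image_mono (Iic_subset_Iio.mpr h))
  obtain ⟨T, hTU, hT⟩ := hfin U fun i w hw =>
    isAlgebraic_of_mul_mem _ (hIic (hlt i w) (hSmem w hw)) (hS0 w hw) (hSshift w hw i)
  -- The separant of v serves all proper derivatives of v: D(S y) = S Dy + y DS, and y DS involves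
  -- only elements below Dy.
  have hUV := hT {w | ∃ v ∈ T, w = v ∨ (v < w ∧ S v * y w ∈ adjoin A (y '' Iio w))}
    (fun v hv => ⟨v, hv, Or.inl rfl⟩) (by
      rintro i w ⟨v, hv, rfl | ⟨hvw, h⟩⟩
      · exact ⟨w, hv, Or.inr ⟨hlt i w, hSshift w (hTU hv) i⟩⟩
      · refine ⟨v, hv, Or.inr ⟨hvw.trans (hlt i w), ?_⟩⟩
        have hd : ∀ b ∈ adjoin A (y '' Iio w),
            DiffRing.d i b ∈ adjoin A (y '' Iio (shift i w)) := fun b hb => by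
          refine d_mem_adjoin i (image_mono (Iio_subset_Iio (hlt i w).le)) ?_ hb
          rintro _ ⟨j, hj, rfl⟩
          rw [hy]
          exact subset_adjoin ⟨_, hs i hj, rfl⟩
        have h1 := hd _ h
        rw [Derivation.leibniz, smul_eq_mul, smul_eq_mul, hy] at h1
        have hyw : y w ∈ adjoin A (y '' Iio (shift i w)) :=
          subset_adjoin (mem_image_of_mem y (hlt i w))
        have h2 := sub_mem h1 (mul_mem hyw (hd _ (hIic hvw (hSmem v (hTU hv)))))
        rwa [add_sub_cancel_right] at h2)
  let f : B →ₐ[A] FractionRing B := IsScalarTower.toAlgHom A B (FractionRing B)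
  have hf : Function.Injective f := IsFractionRing.injective B (FractionRing B)
  have hx : AlgebraicIndependent A fun w : {w // w ∉ U} => y w := by
    refine algebraicIndependent_of_linearOrder hinj _ fun w halg => w.2 ?_
    have hle : adjoin A ((fun w : {w // w ∉ U} => y w) '' Iio w) ≤ adjoin A (y '' Iio (w : W)) := by
      refine adjoin_mono ?_
      rintro _ ⟨v, hv, rfl⟩
      exact ⟨v, hv, rfl⟩
    exact halg.ringHom_of_comp_eq (Subalgebra.inclusion hle).toRingHom (RingHom.id B)
      (Subalgebra.inclusion_injective hle) rfl
  set x : {w // w ∉ U} → FractionRing B := f ∘ fun w => y w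
  have hxf : AlgebraicIndependent A x := hx.map' hf
  -- By induction on rank all of B is algebraic over A[x], hence so are the inverse separants.
  let K := Subalgebra.algebraicClosure (adjoin A (range x)) (FractionRing B)
  have hK : ∀ w, f (y w) ∈ K := by
    intro w
    induction w using WellFoundedLT.induction with
    | ind w ih =>
      by_cases hw : w ∈ U
      · have hle : adjoin A (y '' Iio w) ≤ (K.restrictScalars A).comap f := by
          refine adjoin_le ?_
          rintro _ ⟨v, hv, rfl⟩
          exact ih v hv
        have halg : IsAlgebraic (adjoin A (y '' Iio w)) (y w) := hw
        have : IsAlgebraic K (f (y w)) :=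
          halg.ringHom_of_comp_eq
            ((f.toRingHom.comp (adjoin A (y '' Iio w)).val.toRingHom).codRestrict K
              fun b => hle b.2) f.toRingHom
            (fun a b hab => Subtype.ext (hf (congrArg Subtype.val hab))) rfl
        exact this.restrictScalars (adjoin A (range x))
      · exact isAlgebraic_algebraMap
          (⟨_, subset_adjoin ⟨⟨w, hw⟩, rfl⟩⟩ : adjoin A (range x))
  have hKle : (⊤ : Subalgebra A B) ≤ (K.restrictScalars A).comap f := by
    rw [← hgen]
    refine adjoin_le ?_
    rintro _ ⟨w, rfl⟩
    exact hK w
  refine exists_forall_isPrime_comap_eq f hxf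
    (T.image (fun w => f (y w)) ∪ T.image fun w => (f (S w))⁻¹) ?_ ?_
  · intro e he
    rcases Finset.mem_union.mp he with he | he
    · obtain ⟨w, -, rfl⟩ := Finset.mem_image.mp he
      exact hK w
    · obtain ⟨w, -, rfl⟩ := Finset.mem_image.mp he
      exact IsAlgebraic.inv (hKle (Algebra.mem_top : S w ∈ _))
  · set M := adjoin A (range x ∪ ((T.image (fun w => f (y w)) ∪ T.image fun w => (f (S w))⁻¹ :
      Finset (FractionRing B)) : Set (FractionRing B)))
    have hMy : ∀ w, f (y w) ∈ M := by
      intro w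
      induction w using WellFoundedLT.induction with
      | ind w ih =>
        by_cases hw : w ∈ U
        · obtain ⟨v, hv, rfl | ⟨-, h⟩⟩ := hUV hw
          · exact subset_adjoin (Or.inr (Finset.mem_coe.mpr (Finset.mem_union_left _
              (Finset.mem_image_of_mem _ hv))))
          · have hle : adjoin A (y '' Iio w) ≤ M.comap f := by
              refine adjoin_le ?_
              rintro _ ⟨v, hv, rfl⟩
              exact ih v hv
            have hinv : (f (S v))⁻¹ ∈ M := subset_adjoin (Or.inr (Finset.mem_coe.mpr
              (Finset.mem_union_right _ (Finset.mem_image_of_mem _ hv))))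
            have h0 : f (S v) ≠ 0 := (map_ne_zero_iff f hf).mpr (hS0 v (hTU hv))
            have : _ * f (S v * y w) ∈ M := M.mul_mem hinv (hle h)
            rwa [map_mul, inv_mul_cancel_left₀ h0] at this
        · exact subset_adjoin (Or.inl ⟨⟨w, hw⟩, rfl⟩)
    have hle : (⊤ : Subalgebra A B) ≤ M.comap f := by
      rw [← hgen]
      refine adjoin_le ?_
      rintro _ ⟨w, rfl⟩
      exact hMy w
    rintro _ ⟨b, rfl⟩
    exact hle Algebra.mem_top

end

/-! ### Derivative operators, Dickson's lemma and the ranking -/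

/-- The operators `∏ᵢ dᵢ ^ αᵢ`. -/
theorem exists_iteratedDerivatives (Δ : Type*) [Finite Δ] (B : Type*) [CommRing B] [DiffRing Δ B] :
    ∃ θ : (Δ →₀ ℕ) → B → B, (∀ b, θ 0 b = b) ∧
      ∀ i α b, DiffRing.d i (θ α b) = θ (Finsupp.single i 1 + α) b := by
  classical
  have := Fintype.ofFinite Δ
  let φ : ∀ _ : Δ, Multiplicative ℕ →* Module.End ℤ B :=
    fun i => powersHom _ (DiffRing.d (A := B) i).toLinearMap
  have hcomm : Pairwise fun i j => ∀ x y, Commute (φ i x) (φ j y) := by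
    intro i j _ x y
    have h : Commute (DiffRing.d (A := B) i).toLinearMap (DiffRing.d (A := B) j).toLinearMap :=
      LinearMap.ext fun b => DiffRing.d_comm i j b
    exact h.pow_pow _ _
  let Θ := MonoidHom.noncommPiCoprod φ hcomm
  refine ⟨fun α => Θ fun i => Multiplicative.ofAdd (α i), fun b => ?_, fun i α b => ?_⟩
  · have : (fun i => Multiplicative.ofAdd ((0 : Δ →₀ ℕ) i)) = 1 := rfl
    beta_reduce
    rw [this, map_one, Module.End.one_apply]
  · have h : (fun j => Multiplicative.ofAdd ((Finsupp.single i 1 + α : Δ →₀ ℕ) j)) =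
        Pi.mulSingle i (Multiplicative.ofAdd 1) * fun j => Multiplicative.ofAdd (α j) := by
      funext j
      rw [Finsupp.add_apply, ofAdd_add, Pi.mul_apply]
      congr 1
    beta_reduce
    rw [h, map_mul, MonoidHom.noncommPiCoprod_mulSingle, Module.End.mul_apply]
    simp [φ]

/-- Dickson's lemma for sets of derivatives of finitely many indeterminates. -/
theorem exists_finset_generating_upperSet {Δ ι : Type*} [Finite Δ] [Finite ι]
    (U : Set ((Δ →₀ ℕ) × ι)) :
    ∃ T : Finset ((Δ →₀ ℕ) × ι), ↑T ⊆ U ∧ ∀ V : Set ((Δ →₀ ℕ) × ι), ↑T ⊆ V →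
      (∀ i, ∀ w ∈ V, (Finsupp.single i 1 + w.1, w.2) ∈ V) → U ⊆ V := by
  have hfin : {w : (Δ →₀ ℕ) × ι | Minimal (fun α => (α, w.2) ∈ U) w.1}.Finite := by
    have : {w : (Δ →₀ ℕ) × ι | Minimal (fun α => (α, w.2) ∈ U) w.1} =
        ⋃ j, (fun α => (α, j)) '' {α | Minimal (fun α => (α, j) ∈ U) α} := by
      ext ⟨α, j⟩
      simp
    rw [this]
    exact Set.finite_iUnion fun j =>
      (WellQuasiOrderedLE.finite_of_isAntichain (setOfPred_minimal_antichain _)).image _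
  refine ⟨hfin.toFinset, fun w hw => ?_, fun V hTV hV => ?_⟩
  · rw [Set.Finite.coe_toFinset] at hw
    exact Minimal.prop (P := fun α => (α, w.2) ∈ U) hw
  · rintro ⟨α, j⟩ hα
    -- Every exponent in U is reached from a minimal one by adding unit vectors.
    obtain ⟨β, hβα, hβ⟩ := exists_minimal_le_of_wellFoundedLT (fun α => (α, j) ∈ U) α hα
    obtain ⟨γ, rfl⟩ := exists_add_of_le hβα
    have hβV : (β, j) ∈ V := hTV (by simpa using hβ)
    have hstep : ∀ (i : Δ) (n : ℕ) (δ : Δ →₀ ℕ), (δ, j) ∈ V → (Finsupp.single i n + δ, j) ∈ V := by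
      intro i n
      induction n with
      | zero => simp
      | succ n ih =>
        intro δ hδ
        have := hV i _ (ih δ hδ)
        rwa [← add_assoc, ← Finsupp.single_add, add_comm 1 n] at this
    clear hα hβα
    rw [add_comm]
    induction γ using Finsupp.induction with
    | zero => simpa using hβV
    | single_add i n γ _ _ ih =>
      rw [add_assoc]
      exact hstep i n _ ih

theorem exists_prime_over {Δ : Type*} [Finite Δ] {A B : Type*} [CommRing A] [CommRing B]
    [IsDomain B] [CharZero B] [DiffRing Δ A] [DiffRing Δ B] [Algebra A B] [DiffAlgebra Δ A B]
    (hinj : Function.Injective (algebraMap A B)) (hfg : DiffFinitelyGenerated Δ A B) :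
    ∃ s : A, s ≠ 0 ∧ ∀ p : Ideal A, p.IsPrime → s ∉ p →
      ∃ q : Ideal B, q.IsPrime ∧ q.comap (algebraMap A B) = p := by
  classical
  obtain ⟨G, hG⟩ := hfg
  obtain ⟨θ, hθ0, hθ⟩ := exists_iteratedDerivatives Δ B
  let : LinearOrder Δ := linearOrderOfSTO WellOrderingRel
  have : WellFoundedGT Δ := Finite.to_wellFoundedGT
  let m : MonomialOrder Δ := MonomialOrder.degLex
  let e := G.equivFin
  -- Exponents are compared first and generators break ties, so every derivation is strictly
  -- increasing on W.
  let W := m.syn ×ₗ Fin G.card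
  let φ : W ≃ (Δ →₀ ℕ) × Fin G.card := ofLex.trans (m.toSyn.symm.toEquiv.prodCongr (Equiv.refl _))
  let shift : Δ → W → W := fun i w =>
    toLex (m.toSyn (Finsupp.single i 1) + (ofLex w).1, (ofLex w).2)
  have hφ : ∀ i w, φ (shift i w) = (Finsupp.single i 1 + (φ w).1, (φ w).2) := by
    intro i w
    refine Prod.ext ?_ rfl
    change m.toSyn.symm (m.toSyn _ + _) = _
    rw [map_add, m.toSyn.symm_apply_apply]
    rfl
  let y : W → B := fun w => θ (φ w).1 (e.symm (φ w).2)
  have hy : ∀ i w, DiffRing.d i (y w) = y (shift i w) := by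
    intro i w
    simp only [y, hφ, hθ]
  refine exists_prime_over_of_ranking (shift := shift) (y := y) hinj ?_ ?_ hy ?_ ?_
  · intro i v w hvw
    rw [Prod.Lex.lt_iff] at hvw ⊢
    rcases hvw with h | ⟨h, h'⟩
    · exact Or.inl (add_lt_add_right h _)
    · exact Or.inr ⟨congrArg (m.toSyn (Finsupp.single i 1) + ·) h, h'⟩
  · intro i w
    rw [Prod.Lex.lt_iff]
    refine Or.inl (lt_add_of_pos_left _ ?_)
    rw [← map_zero m.toSyn]
    refine (m.toSyn_monotone zero_le).lt_of_ne (m.toSyn.injective.ne ?_)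
    simp [eq_comm]
  · rw [eq_top_iff, ← hG]
    refine sInf_le ⟨fun g hg => Algebra.subset_adjoin ?_, fun i b hb => ?_⟩
    · refine ⟨φ.symm (0, e ⟨g, hg⟩), ?_⟩
      simp [y, hθ0]
    · refine d_mem_adjoin i subset_rfl ?_ hb
      rintro _ ⟨w, rfl⟩
      rw [hy]
      exact Algebra.subset_adjoin ⟨_, rfl⟩
  · intro U _
    obtain ⟨T, hTU, hT⟩ := exists_finset_generating_upperSet (φ.symm ⁻¹' U)
    refine ⟨T.map φ.symm.toEmbedding, ?_, fun V hTV hV w hw => ?_⟩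
    · intro w hw
      obtain ⟨x, hx, rfl⟩ := Finset.mem_map.mp (Finset.mem_coe.mp hw)
      exact hTU hx
    · have h := hT (φ.symm ⁻¹' V) (fun x hx => hTV (Finset.mem_coe.mpr
        (Finset.mem_map_of_mem _ hx))) (fun i x hx => by
          have h := hV i (φ.symm x) hx
          rw [← φ.symm_apply_apply (shift i (φ.symm x)), hφ, φ.apply_symm_apply] at h
          exact h)
        (show φ w ∈ φ.symm ⁻¹' U by simpa using hw)
      simpa using h

/-! ### Passage to the localizations -/

instance instDiffAlgebraAway {Δ A : Type*} [CommRing A] [DiffRing Δ A] (s : A) :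
    DiffAlgebra Δ A (Localization.Away s) :=
  ⟨fun i a => (d_algebraMap_away s i a).symm⟩

end DifferentialSpectrum

open DifferentialSpectrum in
theorem mainTheorem8 {Δ : Type*} [Finite Δ] {A B : Type*} [CommRing A] [CommRing B]
    [Algebra ℚ A] [Algebra ℚ B] [IsDomain B]
    [DifferentialSpectrum.DiffRing Δ A] [DifferentialSpectrum.DiffRing Δ B]
    [Algebra A B] [DifferentialSpectrum.DiffAlgebra Δ A B]
    (hinj : Function.Injective (algebraMap A B))
    (hfg : DifferentialSpectrum.DiffFinitelyGenerated Δ A B) :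
    ∃ s : A, s ≠ 0 ∧
      Function.Surjective
        (DifferentialSpectrum.DiffSpec.comap (DifferentialSpectrum.awayDiffHom Δ A B s)) := by
  have : CharZero B := algebraRat.charZero B
  obtain ⟨s, hs0, hs⟩ := exists_prime_over hinj hfg
  refine ⟨s, hs0, fun P => ?_⟩
  let p : Ideal A := P.1.asIdeal.comap (algebraMap A (Localization.Away s))
  have hp : p.IsPrime := Ideal.comap_isPrime _ _
  have hpD : IsDiffIdeal Δ p := fun i a ha => by
    rw [Ideal.mem_comap, ← d_algebraMap_away]
    exact P.2 i _ ha
  have hsp : s ∉ p := fun h => P.1.isPrime.ne_top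
    (Ideal.eq_top_of_isUnit_mem _ h (IsLocalization.Away.algebraMap_isUnit s))
  obtain ⟨q, hq, hqp⟩ := hs p hp hsp
  obtain ⟨q', hq', hqD, hle, hmax⟩ := exists_isPrime_isDiffIdeal_le (Δ := Δ) q
  have hq'p : q'.comap (algebraMap A B) = p := le_antisymm
    ((Ideal.comap_mono hle).trans hqp.le)
    (Ideal.map_le_iff_le_comap.mp (hmax _ (isDiffIdeal_map hpD)
      (Ideal.map_le_iff_le_comap.mpr hqp.ge)))
  have hsq : algebraMap A B s ∉ q' := fun h => hsp (hq'p ▸ h)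
  have hdisj : Disjoint (Submonoid.powers (algebraMap A B s) : Set B) q' :=
    (Ideal.disjoint_powers_iff_notMem _ hq'.isRadical).mpr hsq
  let Q : Ideal (Localization.Away (algebraMap A B s)) := q'.map (algebraMap B _)
  have hQ : Q.IsPrime := IsLocalization.isPrime_of_isPrime_disjoint
    (Submonoid.powers (algebraMap A B s)) _ q' hq' hdisj
  have hQq : Q.comap (algebraMap B _) = q' := IsLocalization.under_map_of_isPrime_disjoint
    (Submonoid.powers (algebraMap A B s)) _ hq' hdisj
  refine ⟨⟨⟨Q, hQ⟩, isDiffIdeal_map hqD⟩, Subtype.ext (PrimeSpectrum.ext ?_)⟩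
  change Q.comap (Localization.awayMap (algebraMap A B) s) = P.1.asIdeal
  -- An ideal of the localization of A is the extension of its contraction, so comparing
  -- contractions to A suffices.
  rw [← IsLocalization.map_under (Submonoid.powers s) _
      (Q.comap (Localization.awayMap (algebraMap A B) s)),
    ← IsLocalization.map_under (Submonoid.powers s) _ P.1.asIdeal]
  congr 1
  change (Q.comap _).comap (algebraMap A _) = p
  rw [Ideal.comap_comap, Localization.awayMap, IsLocalization.Away.map, IsLocalization.map_comp,
    ← Ideal.comap_comap, hQq, hq'p]
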